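/- Let $d\ge 1$, let $\mathcal M_d$ be the complex $d\times d$ matrices and let $T:\mathcal M_d\to\mathcal M_d$ be a doubly stochastic quantum channel, i.e. a completely positive, trace preserving linear map with $T(\mathbb 1_d)=T^*(\mathbb 1_d)=\mathbb 1_d$, where $T^*$ is the adjoint with respect to the Hilbert–Schmidt scalar product. Suppose that $T^*T$ is primitive, i.e. $\lim_{n\to\infty}(T^*T)^n(\rho)=\mathbb 1_d/d$ for every density matrix $\rho\in\mathcal M_d$. Define the discrete logarithmic Sobolev constant $$\alpha_D(T)=\frac12\,\inf_X\frac{\mathcal E(X)}{\mathrm{Ent}_2(X)},\qquad \mathcal E(X)=-\frac1d\operatorname{tr}\big[(T^*T-\mathrm{id})(X)\,X\big],\qquad \mathrm{Ent}_2(X)=\frac1{2d}\operatorname{tr}\Big[X^2\Big(\log\frac{X^2}{\operatorname{tr}(X^2)}+\log d\Big)\Big],$$ where the infimum is over all strictly positive $X\in\mathcal M_d$ with $\mathrm{Ent}_2(X)\neq 0$, i.e. that are not multiples of $\mathbb 1_d$ (it is $+\infty$ if there are none, that is, if $d=1$). For $1\le p<\infty$ let $\|Y\|_{p,\mathbb 1_d/d}=d^{-1/p}(\operatorname{tr}|Y|^p)^{1/p}$,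 where $|Y|=(Y^\dagger Y)^{1/2}$, and put $$\|T\|_{2\to q,\mathbb 1_d/d}=\sup_{0\ne Y\in\mathcal M_d}\frac{\|T(Y)\|_{q,\mathbb 1_d/d}}{\|Y\|_{2,\mathbb 1_d/d}}.$$ Then $\|T\|_{2\to q,\mathbb 1_d/d}\le 1$ for every real $q\ge 1$ with $q\le 2+2\alpha_D(T)$. -/

import Mathlib

open scoped ENNReal ComplexOrder

namespace QHyper

/-- The complex `d × d` matrices. -/
abbrev Mat (d : ℕ) : Type := Matrix (Fin d) (Fin d) ℂ

/-- The map `id_k ⊗ T` on `M_k ⊗ M_d`, i.e. `T` applied to each of the `k²` blocks. -/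
def ampliation {d : ℕ} (T : Mat d →ₗ[ℂ] Mat d) (k : ℕ)
    (A : Matrix (Fin k × Fin d) (Fin k × Fin d) ℂ) :
    Matrix (Fin k × Fin d) (Fin k × Fin d) ℂ :=
  Matrix.of fun x y => T (Matrix.of fun i j => A (x.1, i) (y.1, j)) x.2 y.2

/-- Complete positivity: every `id_k ⊗ T` maps positive semidefinite matrices to positive
semidefinite matrices. -/
def IsCompletelyPositive {d : ℕ} (T : Mat d →ₗ[ℂ] Mat d) : Prop :=
  ∀ (k : ℕ) (A : Matrix (Fin k × Fin d) (Fin k × Fin d) ℂ),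
    A.PosSemidef → (ampliation T k A).PosSemidef

/-- A quantum channel: a completely positive, trace preserving linear map. -/
structure IsQuantumChannel {d : ℕ} (T : Mat d →ₗ[ℂ] Mat d) : Prop where
  completelyPositive : IsCompletelyPositive T
  trace_preserving : ∀ X : Mat d, (T X).trace = X.trace

/-- The adjoint `T*` with respect to the Hilbert-Schmidt scalar product `⟨X, Y⟩ = tr (Xᴴ Y)`,
given by its entries `(T* Y)_{ij} = ⟨E_{ij}, T* Y⟩ = ⟨T E_{ij}, Y⟩`; see `trace_hsAdjoint` for
the defining property. -/
def hsAdjoint {d : ℕ} (T : Mat d →ₗ[ℂ] Mat d) : Mat d →ₗ[ℂ] Mat d where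
  toFun Y := Matrix.of fun i j => ((T (Matrix.single i j 1)).conjTranspose * Y).trace
  map_add' Y Z := by
    ext i j
    simp [Matrix.mul_add]
  map_smul' c Y := by
    ext i j
    simp

theorem trace_hsAdjoint {d : ℕ} (T : Mat d →ₗ[ℂ] Mat d) (X Y : Mat d) :
    (X.conjTranspose * hsAdjoint T Y).trace = ((T X).conjTranspose * Y).trace := by
  have hX : T X = ∑ i, ∑ j, X i j • T (Matrix.single i j 1) := by
    conv_lhs => rw [Matrix.matrix_eq_sum_single X]
    rw [map_sum]
    refine Finset.sum_congr rfl fun i _ => ?_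
    rw [map_sum]
    refine Finset.sum_congr rfl fun j _ => ?_
    rw [← map_smul, Matrix.smul_single, smul_eq_mul, mul_one]
  rw [hX]
  simp only [Matrix.conjTranspose_sum, Matrix.conjTranspose_smul, Matrix.sum_mul,
    Matrix.smul_mul, Matrix.trace_sum, Matrix.trace_smul]
  rw [Finset.sum_comm]
  simp [Matrix.trace, Matrix.mul_apply, hsAdjoint]

/-- A doubly stochastic quantum channel: `T(1) = T*(1) = 1`. -/
structure IsDoublyStochasticChannel {d : ℕ} (T : Mat d →ₗ[ℂ] Mat d) : Prop where
  channel : IsQuantumChannel T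
  map_one : T 1 = 1
  adjoint_map_one : hsAdjoint T 1 = 1

/-- Density matrices. -/
def IsState {d : ℕ} (ρ : Mat d) : Prop := ρ.PosSemidef ∧ ρ.trace = 1

/-- Primitivity of a doubly stochastic channel `P`: `Pⁿ(ρ) → 1/d` for every state `ρ`. -/
def IsPrimitive {d : ℕ} (P : Mat d →ₗ[ℂ] Mat d) : Prop :=
  ∀ ρ : Mat d, IsState ρ →
    Filter.Tendsto (fun n : ℕ => (P ^ n) ρ) Filter.atTop (nhds ((d : ℂ)⁻¹ • (1 : Mat d)))

/-- The 2-Dirichlet form `-(1/d) tr[L(X) X]` of a linear map `L`. -/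
noncomputable def dirichlet2 {d : ℕ} (L : Mat d →ₗ[ℂ] Mat d) (X : Mat d) : ℝ :=
  -(1 / (d : ℝ)) * (L X * X).trace.re

/-- The 2-relative entropy `(1/(2d)) tr[X² (log (X² / tr X²) + log d)]`, for strictly positive
`X`; the matrix logarithm is taken through the continuous functional calculus. -/
noncomputable def ent2 {d : ℕ} (X : Mat d) : ℝ :=
  1 / (2 * (d : ℝ)) *
    (X ^ 2 * (cfc Real.log (((X ^ 2).trace)⁻¹ • X ^ 2) + Real.log d • (1 : Mat d))).trace.re

/-- The LS-2 constant: the infimum of `dirichlet2 L X / ent2 X` over all strictly positive `X`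
for which the quotient makes sense, i.e. those which are not multiples of the identity. It is an
infimum of extended reals, so it is `⊤` if there is no such `X` (which happens for `d = 1`). -/
noncomputable def ls2Const {d : ℕ} (L : Mat d →ₗ[ℂ] Mat d) : EReal :=
  ⨅ (X : Mat d) (_ : X.PosDef ∧ ent2 X ≠ 0), ((dirichlet2 L X / ent2 X : ℝ) : EReal)

/-- The discrete LS constant `α_D(T) = (1/2) α_2(T*T - id)`. -/
noncomputable def discreteLSConst {d : ℕ} (T : Mat d →ₗ[ℂ] Mat d) : EReal :=
  ((1 / 2 : ℝ) : EReal) * ls2Const (hsAdjoint T ∘ₗ T - LinearMap.id)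

/-- The absolute value `|Y| = (Yᴴ Y)^{1/2}`. -/
noncomputable def matAbs {d : ℕ} (Y : Mat d) : Mat d :=
  cfc Real.sqrt (Y.conjTranspose * Y)

/-- The `1/d`-weighted `p`-norm `d^{-1/p} (tr |Y|^p)^{1/p}`. -/
noncomputable def wnorm {d : ℕ} (p : ℝ) (Y : Mat d) : ℝ :=
  1 / (d : ℝ) ^ (1 / p) * (cfc (fun s : ℝ => s ^ p) (matAbs Y)).trace.re ^ (1 / p)

/-- The `p → q` norm of `T` with respect to the weighted norms, as a supremum over all nonzero
complex matrices. -/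
noncomputable def opNorm {d : ℕ} (p q : ℝ) (T : Mat d →ₗ[ℂ] Mat d) : ℝ≥0∞ :=
  ⨆ (Y : Mat d) (_ : Y ≠ 0), ENNReal.ofReal (wnorm q (T Y) / wnorm p Y)

end QHyper

/-!
For `q ≤ 2` the bound is monotonicity of the weighted norms together with the Kadison–Schwarz
inequality. Let `q > 2`. For `A > 0` and `X = A ^ (q / 2)`, Jensen's inequality in an eigenbasis
of `T A` gives `tr (T A) ^ q ≤ tr (T X) ^ 2`; the logarithmic Sobolev inequality at `X` bounds
`d⁻¹ tr (T X) ^ 2` by `d⁻¹ tr X ^ 2 - (q - 2) Ent₂ X`, and this is at most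
`(d⁻¹ tr A ^ 2) ^ (q / 2)` by an inequality about the eigenvalues of `X` alone. The resulting
estimate extends to `A ≥ 0` by approximation. For an arbitrary `Y`, the block matrix
`[[|Yᴴ|, Y], [Yᴴ, |Y|]]` is positive, and so is its image under `id₂ ⊗ T`; hence
`2 tr |T Y| ^ q ≤ tr (T |Yᴴ|) ^ q + tr (T |Y|) ^ q`, where `|Yᴴ|` and `|Y|` have the same
Hilbert–Schmidt norm as `Y`.
-/

namespace QHyper

open Matrix
open scoped MatrixOrder

section TraceFunctional

variable {n m 𝕜 : Type*} [RCLike 𝕜]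

theorem posSemidef_fromBlocks_zero [Finite n] [Finite m] {A : Matrix n n 𝕜} {D : Matrix m m 𝕜}
    (hA : A.PosSemidef) (hD : D.PosSemidef) : (fromBlocks A 0 0 D).PosSemidef := by
  classical
  cases nonempty_fintype n
  cases nonempty_fintype m
  obtain ⟨R, rfl⟩ := CStarAlgebra.nonneg_iff_eq_star_mul_self.1 hA.nonneg
  obtain ⟨S, rfl⟩ := CStarAlgebra.nonneg_iff_eq_star_mul_self.1 hD.nonneg
  simpa [fromBlocks_conjTranspose, fromBlocks_multiply, star_eq_conjTranspose] using
    posSemidef_conjTranspose_mul_self (fromBlocks R 0 0 S)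

variable [Fintype n] [Fintype m]

/-- The linear functional `A ↦ ⟨uᵢ, A uᵢ⟩`, where `uᵢ` is the `i`-th column of `U`. -/
def diagEntry (U : Matrix n n 𝕜) (i : n) : Matrix n n 𝕜 →ₗ[𝕜] 𝕜 where
  toFun A := (Uᴴ * A * U) i i
  map_add' A B := by simp only [Matrix.mul_add, Matrix.add_mul, Matrix.add_apply]
  map_smul' c A := by
    simp only [Matrix.mul_smul, Matrix.smul_mul, Matrix.smul_apply, RingHom.id_apply]

theorem diagEntry_apply (U : Matrix n n 𝕜) (i : n) (A : Matrix n n 𝕜) :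
    diagEntry U i A = (Uᴴ * A * U) i i :=
  rfl

theorem diagEntry_nonneg (U : Matrix n n 𝕜) (i : n) {A : Matrix n n 𝕜} (hA : A.PosSemidef) :
    0 ≤ diagEntry U i A :=
  (hA.conjTranspose_mul_mul_same U).diag_nonneg

variable [DecidableEq n] [DecidableEq m]

theorem continuousOn_spectrum_real (A : Matrix n n 𝕜) (f : ℝ → ℝ) :
    ContinuousOn f (spectrum ℝ A) :=
  A.finite_real_spectrum.continuousOn f

/-- The real part of `tr f(A)`. -/
noncomputable def traceFun (f : ℝ → ℝ) (A : Matrix n n 𝕜) : ℝ :=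
  RCLike.re (cfc f A).trace

theorem traceFun_eq_sum_eigenvalues {A : Matrix n n 𝕜} (hA : A.IsHermitian) (f : ℝ → ℝ) :
    traceFun f A = ∑ i, f (hA.eigenvalues i) := by
  rw [traceFun, hA.cfc_eq, IsHermitian.cfc, Unitary.conjStarAlgAut_apply, trace_mul_comm,
    ← Matrix.mul_assoc, Unitary.coe_star_mul_self, Matrix.one_mul, trace_diagonal]
  simp

theorem traceFun_eq_sum_roots {A : Matrix n n 𝕜} (hA : A.IsHermitian) (f : ℝ → ℝ) :
    traceFun f A = (A.charpoly.roots.map fun z => f (RCLike.re z)).sum := by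
  rw [traceFun_eq_sum_eigenvalues hA, hA.roots_charpoly_eq_eigenvalues]
  simp

theorem traceFun_fromBlocks {A : Matrix n n 𝕜} {D : Matrix m m 𝕜} (hA : A.IsHermitian)
    (hD : D.IsHermitian) (f : ℝ → ℝ) :
    traceFun f (fromBlocks A 0 0 D) = traceFun f A + traceFun f D := by
  rw [traceFun_eq_sum_roots (hA.fromBlocks (by simp) hD), traceFun_eq_sum_roots hA,
    traceFun_eq_sum_roots hD, charpoly_fromBlocks_zero₁₂,
    Polynomial.roots_mul (A.charpoly_monic.mul D.charpoly_monic).ne_zero, Multiset.map_add,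
    Multiset.sum_add]

theorem traceFun_mul_conjTranspose_self (Y : Matrix n n 𝕜) (f : ℝ → ℝ) :
    traceFun f (Y * Yᴴ) = traceFun f (Yᴴ * Y) := by
  rw [traceFun_eq_sum_roots (isHermitian_mul_conjTranspose_self Y),
    traceFun_eq_sum_roots (isHermitian_conjTranspose_mul_self Y), charpoly_mul_comm]

theorem traceFun_cfc {A : Matrix n n 𝕜} (hA : A.IsHermitian) (f g : ℝ → ℝ) :
    traceFun g (cfc f A) = traceFun (fun x => g (f x)) A := by
  rw [traceFun, traceFun, cfc_comp' g f A ((A.finite_real_spectrum.image f).continuousOn g)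
    (continuousOn_spectrum_real A f) hA.isSelfAdjoint]

theorem traceFun_sq {A : Matrix n n 𝕜} (hA : A.IsHermitian) :
    traceFun (fun x => x ^ 2) A = RCLike.re (A * A).trace := by
  rw [traceFun, cfc_pow_id A 2 hA.isSelfAdjoint, sq]

theorem trace_cfc (f : ℝ → ℝ) (A : Matrix n n 𝕜) : (cfc f A).trace = (traceFun f A : 𝕜) := by
  refine (RCLike.conj_eq_iff_re.1 ?_).symm
  have h : (cfc f A)ᴴ = cfc f A := cfc_predicate (R := ℝ) f A
  conv_rhs => rw [← h]
  exact (trace_conjTranspose _).symm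

theorem traceFun_congr {A : Matrix n n 𝕜} {f g : ℝ → ℝ}
    (h : Set.EqOn f g (spectrum ℝ A)) : traceFun f A = traceFun g A := by
  rw [traceFun, cfc_congr h, traceFun]

theorem traceFun_nonneg {f : ℝ → ℝ} {A : Matrix n n 𝕜} (h : ∀ x ∈ spectrum ℝ A, 0 ≤ f x) :
    0 ≤ traceFun f A :=
  (RCLike.nonneg_iff.1 (cfc_nonneg h).posSemidef.trace_nonneg).1

theorem diagEntry_one (U : unitaryGroup n 𝕜) (i : n) : diagEntry (U : Matrix n n 𝕜) i 1 = 1 := by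
  rw [diagEntry_apply, Matrix.mul_one, ← star_eq_conjTranspose, Unitary.coe_star_mul_self,
    one_apply_eq]

theorem sum_re_diagEntry (U : unitaryGroup n 𝕜) (A : Matrix n n 𝕜) :
    ∑ i, RCLike.re (diagEntry (U : Matrix n n 𝕜) i A) = RCLike.re A.trace := by
  rw [← map_sum]
  change RCLike.re ((U : Matrix n n 𝕜)ᴴ * A * (U : Matrix n n 𝕜)).trace = _
  rw [trace_mul_comm, ← Matrix.mul_assoc, ← star_eq_conjTranspose,
    mem_unitaryGroup_iff.1 U.2, Matrix.one_mul]

theorem diagEntry_eigenvectorUnitary {A : Matrix n n 𝕜} (hA : A.IsHermitian) (i : n) :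
    diagEntry (hA.eigenvectorUnitary : Matrix n n 𝕜) i A = hA.eigenvalues i := by
  have h := hA.conjStarAlgAut_star_eigenvectorUnitary
  rw [Unitary.conjStarAlgAut_star_apply] at h
  exact (congrFun₂ h i i).trans (diagonal_apply_eq _ i)

theorem cfc_eq_sum_vecMulVec {A : Matrix n n 𝕜} (hA : A.IsHermitian) (f : ℝ → ℝ) :
    cfc f A = ∑ k, (f (hA.eigenvalues k) : 𝕜) •
      vecMulVec (hA.eigenvectorBasis k) (star (hA.eigenvectorBasis k)) := by
  ext i j
  rw [hA.cfc_eq, IsHermitian.cfc, Unitary.conjStarAlgAut_apply, Matrix.mul_apply, Matrix.sum_apply]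
  refine Finset.sum_congr rfl fun k _ => ?_
  simp [mul_diagonal, vecMulVec_apply]
  ring

theorem jensen_map_cfc {φ : Matrix n n 𝕜 →ₗ[𝕜] 𝕜}
    (hφ : ∀ P : Matrix n n 𝕜, P.PosSemidef → 0 ≤ φ P) (h1 : φ 1 = 1) {s : Set ℝ}
    {f : ℝ → ℝ} (hf : ConvexOn ℝ s f) {A : Matrix n n 𝕜} (hA : A.IsHermitian)
    (hs : ∀ k, hA.eigenvalues k ∈ s) :
    f (RCLike.re (φ A)) ≤ RCLike.re (φ (cfc f A)) := by
  set P : n → Matrix n n 𝕜 := fun k =>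
    vecMulVec (hA.eigenvectorBasis k) (star (hA.eigenvectorBasis k))
  set w : n → ℝ := fun k => RCLike.re (φ (P k))
  have expand (g : ℝ → ℝ) : RCLike.re (φ (cfc g A)) = ∑ k, w k • g (hA.eigenvalues k) := by
    rw [cfc_eq_sum_vecMulVec hA]
    simp only [map_sum, map_smul, smul_eq_mul, RCLike.re_ofReal_mul, w, P, mul_comm]
  have hw : ∀ k ∈ Finset.univ, 0 ≤ w k := fun k _ =>
    (RCLike.nonneg_iff.1 (hφ _ (posSemidef_vecMulVec_self_star _))).1
  have hw1 : ∑ k, w k = 1 := by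
    simpa [cfc_const_one ℝ A hA.isSelfAdjoint, h1] using (expand fun _ => 1).symm
  have hid := expand id
  rw [cfc_id ℝ A hA.isSelfAdjoint] at hid
  rw [hid, expand f]
  exact hf.map_sum_le hw hw1 fun k _ => hs k

theorem sum_apply_diagEntry_le_traceFun (U : unitaryGroup n 𝕜) {s : Set ℝ} {f : ℝ → ℝ}
    (hf : ConvexOn ℝ s f) {A : Matrix n n 𝕜} (hA : A.IsHermitian)
    (hs : ∀ k, hA.eigenvalues k ∈ s) :
    ∑ i, f (RCLike.re (diagEntry (U : Matrix n n 𝕜) i A)) ≤ traceFun f A := by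
  rw [traceFun, ← sum_re_diagEntry U]
  exact Finset.sum_le_sum fun i _ =>
    jensen_map_cfc (fun _ => diagEntry_nonneg _ i) (diagEntry_one U i) hf hA hs

theorem traceFun_abs_le {f : ℝ → ℝ} (hf : ConvexOn ℝ (Set.Ici 0) f)
    (hmono : MonotoneOn f (Set.Ici 0)) {K D : Matrix n n 𝕜} (hK : K.IsHermitian)
    (hsub : (D - K).PosSemidef) (hadd : (D + K).PosSemidef) :
    traceFun (fun x => f |x|) K ≤ traceFun f D := by
  have hD : D.PosSemidef := by
    convert (hsub.add hadd).smul (inv_nonneg.2 (zero_le_two (α := ℝ))) using 1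
    module
  rw [traceFun_eq_sum_eigenvalues hK]
  refine le_trans (Finset.sum_le_sum fun i _ => ?_) (sum_apply_diagEntry_le_traceFun
    hK.eigenvectorUnitary hf hD.isHermitian hD.eigenvalues_nonneg)
  set ω := diagEntry (hK.eigenvectorUnitary : Matrix n n 𝕜) i
  have hω : RCLike.re (ω K) = hK.eigenvalues i := by
    rw [diagEntry_eigenvectorUnitary, RCLike.ofReal_re]
  have hle := (RCLike.nonneg_iff.1 (diagEntry_nonneg _ i hsub : 0 ≤ ω _)).1
  have hge := (RCLike.nonneg_iff.1 (diagEntry_nonneg _ i hadd : 0 ≤ ω _)).1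
  rw [map_sub, map_sub, hω] at hle
  rw [map_add, map_add, hω] at hge
  have habs : |hK.eigenvalues i| ≤ RCLike.re (ω D) := abs_le.2 ⟨by linarith, by linarith⟩
  exact hmono (Set.mem_Ici.2 (abs_nonneg _)) (Set.mem_Ici.2 ((abs_nonneg _).trans habs)) habs

theorem traceFun_mono {f : ℝ → ℝ} (hf : ConvexOn ℝ (Set.Ici 0) f)
    (hmono : MonotoneOn f (Set.Ici 0)) {A B : Matrix n n 𝕜} (hA : A.PosSemidef)
    (hAB : (B - A).PosSemidef) : traceFun f A ≤ traceFun f B := by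
  have hadd : (B + A).PosSemidef := by
    convert (hAB.add hA).add hA using 1
    abel
  refine le_of_eq_of_le (traceFun_congr fun x hx => ?_)
    (traceFun_abs_le hf hmono hA.isHermitian hAB hadd)
  simp only [abs_of_nonneg (spectrum_nonneg_of_nonneg hA.nonneg hx)]

theorem traceFun_le_of_posSemidef_fromBlocks {f : ℝ → ℝ} (hf : ConvexOn ℝ (Set.Ici 0) f)
    (hmono : MonotoneOn f (Set.Ici 0)) {P B Q : Matrix n n 𝕜}
    (h : (fromBlocks P B Bᴴ Q).PosSemidef) :
    2 * traceFun (fun x => f √x) (Bᴴ * B) ≤ traceFun f P + traceFun f Q := by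
  obtain ⟨hP, -, -, hQ⟩ := isHermitian_fromBlocks_iff.1 h.isHermitian
  set K : Matrix (n ⊕ n) (n ⊕ n) 𝕜 := fromBlocks 0 B Bᴴ 0
  have hK : K.IsHermitian := isHermitian_zero.fromBlocks rfl isHermitian_zero
  have hadd : (fromBlocks P 0 0 Q + K).PosSemidef := by simpa [K, fromBlocks_add] using h
  have hsub : (fromBlocks P 0 0 Q - K).PosSemidef := by
    have hflip := h.conjTranspose_mul_mul_same
      (fromBlocks 1 0 0 (-1) : Matrix (n ⊕ n) (n ⊕ n) 𝕜)
    simpa [K, fromBlocks_conjTranspose, fromBlocks_multiply, sub_eq_add_neg, fromBlocks_neg,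
      fromBlocks_add] using hflip
  have hsq : K * K = fromBlocks (B * Bᴴ) 0 0 (Bᴴ * B) := by simp [K, fromBlocks_multiply]
  calc 2 * traceFun (fun x => f √x) (Bᴴ * B) = traceFun (fun x => f √x) (K * K) := by
        rw [hsq, traceFun_fromBlocks (isHermitian_mul_conjTranspose_self B)
          (isHermitian_conjTranspose_mul_self B), traceFun_mul_conjTranspose_self, two_mul]
    _ = traceFun (fun x => f |x|) K := by
        rw [← sq, ← cfc_pow_id (R := ℝ) K 2 hK.isSelfAdjoint, traceFun_cfc hK]
        simp only [Real.sqrt_sq_eq_abs]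
    _ ≤ traceFun f (fromBlocks P 0 0 Q) := traceFun_abs_le hf hmono hK hsub hadd
    _ = traceFun f P + traceFun f Q := traceFun_fromBlocks hP hQ f

theorem posSemidef_fromBlocks_abs (Y : Matrix n n 𝕜) :
    (fromBlocks (CFC.abs Yᴴ) Y Yᴴ (CFC.abs Y)).PosSemidef := by
  set H : Matrix (n ⊕ n) (n ⊕ n) 𝕜 := fromBlocks 0 Y Yᴴ 0
  have hH : H.IsHermitian := isHermitian_zero.fromBlocks rfl isHermitian_zero
  have habs : CFC.abs H = fromBlocks (CFC.abs Yᴴ) 0 0 (CFC.abs Y) := by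
    refine CFC.sqrt_unique ?_ ?_
    · rw [fromBlocks_multiply]
      simp [H, star_eq_conjTranspose, fromBlocks_conjTranspose, fromBlocks_multiply,
        CFC.abs_mul_abs]
    · exact (posSemidef_fromBlocks_zero (CFC.abs_nonneg _).posSemidef
        (CFC.abs_nonneg _).posSemidef).nonneg
  have h : 0 ≤ CFC.abs H + H := by
    rw [CFC.abs_add_self H hH.isSelfAdjoint]
    exact nsmul_nonneg (CFC.posPart_nonneg H) 2
  rw [habs] at h
  simpa [H, fromBlocks_add] using h.posSemidef

theorem posSemidef_cfc_rpow {A : Matrix n n 𝕜} (hA : A.PosSemidef) (p : ℝ) :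
    (cfc (fun x : ℝ => x ^ p) A).PosSemidef :=
  (cfc_nonneg fun _ hx => Real.rpow_nonneg (spectrum_nonneg_of_nonneg hA.nonneg hx) p).posSemidef

theorem posDef_cfc_rpow {A : Matrix n n 𝕜} (hA : A.PosDef) (p : ℝ) :
    (cfc (fun x : ℝ => x ^ p) A).PosDef :=
  isStrictlyPositive_iff_posDef.1 <|
    (cfc_isStrictlyPositive_iff _ A (continuousOn_spectrum_real A _)
      hA.isHermitian.isSelfAdjoint).2 fun _ hx =>
        Real.rpow_pos_of_pos ((isStrictlyPositive_iff_posDef.2 hA).spectrum_pos hx) p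

theorem rpow_half_sq {x : ℝ} (hx : 0 ≤ x) (q : ℝ) : (x ^ (q / 2)) ^ 2 = x ^ q := by
  rw [← Real.rpow_mul_natCast hx, Nat.cast_ofNat, div_mul_cancel₀ q two_ne_zero]

theorem traceFun_rpow_map_le {T : Matrix n n 𝕜 →ₗ[𝕜] Matrix m m 𝕜}
    (hT : ∀ A : Matrix n n 𝕜, A.PosSemidef → (T A).PosSemidef) (h1 : T 1 = 1) {q : ℝ} (hq : 2 ≤ q)
    {A : Matrix n n 𝕜} (hA : A.PosSemidef) :
    traceFun (fun x => x ^ q) (T A) ≤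
      traceFun (fun x => x ^ 2) (T (cfc (fun x : ℝ => x ^ (q / 2)) A)) := by
  have hTA := hT A hA
  have hX := hT _ (posSemidef_cfc_rpow hA (q / 2))
  rw [traceFun_eq_sum_eigenvalues hTA.isHermitian]
  refine le_trans (Finset.sum_le_sum fun i _ => ?_) (sum_apply_diagEntry_le_traceFun
    hTA.isHermitian.eigenvectorUnitary (even_two.convexOn_pow) hX.isHermitian
    fun _ => Set.mem_univ _)
  set ω := diagEntry (hTA.isHermitian.eigenvectorUnitary : Matrix m m 𝕜) i
  have hω : RCLike.re (ω (T A)) = hTA.isHermitian.eigenvalues i := by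
    rw [diagEntry_eigenvectorUnitary, RCLike.ofReal_re]
  have hnonneg := hTA.eigenvalues_nonneg i
  have hpos : ∀ P : Matrix n n 𝕜, P.PosSemidef → 0 ≤ (ω ∘ₗ T) P := fun P hP =>
    diagEntry_nonneg _ i (hT P hP)
  have hone : (ω ∘ₗ T) 1 = 1 := by rw [LinearMap.comp_apply, h1, diagEntry_one]
  have jensen := jensen_map_cfc hpos hone (convexOn_rpow (p := q / 2) (by linarith))
    hA.isHermitian hA.eigenvalues_nonneg
  rw [LinearMap.comp_apply, LinearMap.comp_apply, hω] at jensen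
  rw [← rpow_half_sq hnonneg]
  exact pow_le_pow_left₀ (Real.rpow_nonneg hnonneg _) jensen 2

end TraceFunctional

section KPositive

variable {d : ℕ} {T : Mat d →ₗ[ℂ] Mat d}

/-- `k`-positivity: `id_k ⊗ T` preserves positive semidefiniteness. Complete positivity is
`k`-positivity for every `k`. -/
def IsKPositive (k : ℕ) (T : Mat d →ₗ[ℂ] Mat d) : Prop :=
  ∀ A : Matrix (Fin k × Fin d) (Fin k × Fin d) ℂ, A.PosSemidef → (ampliation T k A).PosSemidef

theorem IsKPositive.map_posSemidef {k : ℕ} [NeZero k] (hT : IsKPositive k T) (A : Mat d)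
    (hA : A.PosSemidef) : (T A).PosSemidef :=
  (hT _ (hA.submatrix (Prod.snd : Fin k × Fin d → Fin d))).submatrix fun i => (0, i)

theorem IsKPositive.map_fromBlocks (hT : IsKPositive 2 T) {A B C D : Mat d}
    (h : (fromBlocks A B C D).PosSemidef) : (fromBlocks (T A) (T B) (T C) (T D)).PosSemidef := by
  let e : Fin 2 × Fin d → Fin d ⊕ Fin d := fun x => ![Sum.inl x.2, Sum.inr x.2] x.1
  convert (hT _ (h.submatrix e)).submatrix (Sum.elim (fun i => (0, i)) fun i => (1, i)) using 1
  ext (i | i) (j | j) <;> rfl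

theorem kadison_schwarz (hT : IsKPositive 2 T) (h1 : T 1 = 1) (Y : Mat d) :
    (T (Y * Yᴴ) - T Y * (T Y)ᴴ).PosSemidef := by
  let _ : Invertible (1 : Mat d) := invertibleOne
  have hblock : (fromBlocks (Y * Yᴴ) Y Yᴴ 1).PosSemidef :=
    (PosDef.fromBlocks₂₂ _ Y PosDef.one).2 (by simpa using PosSemidef.zero)
  have hmap := hT.map_fromBlocks hblock
  rwa [← (isHermitian_fromBlocks_iff.1 hmap.isHermitian).2.1, h1,
    PosDef.fromBlocks₂₂ _ _ PosDef.one, inv_one, Matrix.mul_one] at hmap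

theorem re_trace_map_mul_le (hT : IsKPositive 2 T) (h1 : T 1 = 1)
    (htr : ∀ X, (T X).trace = X.trace) (Y : Mat d) :
    ((T Y)ᴴ * T Y).trace.re ≤ (Yᴴ * Y).trace.re := by
  have htrace := (Complex.nonneg_iff.1 (kadison_schwarz hT h1 Y).trace_nonneg).1
  rwa [trace_sub, htr, Complex.sub_re, trace_mul_comm Y, trace_mul_comm (T Y),
    sub_nonneg] at htrace

end KPositive

section Entropy

theorem sum_sub_entropy_le_rpow {ι : Type*} [Fintype ι] {w F : ι → ℝ} (hw : ∀ i, 0 ≤ w i)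
    (hF : ∀ i, 0 < F i) (hS : 0 < ∑ i, w i * F i) {p : ℝ} (hp : 0 < p) :
    ∑ i, w i * F i - (p - 1) * ∑ i, w i * F i * Real.log (F i / ∑ j, w j * F j) ≤
      (∑ i, w i * F i ^ (1 / p)) ^ p := by
  set S := ∑ i, w i * F i
  set G := ∑ i, w i * F i ^ (1 / p)
  set h := ∑ i, w i * F i / S * Real.log (F i / S)
  have hent : ∑ i, w i * F i * Real.log (F i / S) = S * h := by
    rw [Finset.mul_sum]
    exact Finset.sum_congr rfl fun i _ => by field_simp
  have hmean : ∑ i, w i * F i / S * (F i / S) ^ (1 / p - 1) = G / S ^ (1 / p) := by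
    rw [Finset.sum_div]
    refine Finset.sum_congr rfl fun i _ => ?_
    rw [Real.rpow_sub_one (div_pos (hF i) hS).ne', Real.div_rpow (hF i).le hS.le]
    have := (hF i).ne'
    field_simp
  have hG0 : 0 < G := by
    have hterm : ∀ i, 0 ≤ w i * F i ^ (1 / p) := fun i =>
      mul_nonneg (hw i) (Real.rpow_nonneg (hF i).le _)
    refine (Finset.sum_nonneg fun i _ => hterm i).lt_of_ne' fun h0 => hS.ne' ?_
    refine Finset.sum_eq_zero fun i hi => ?_
    have hwi := mul_eq_zero.1 ((Finset.sum_eq_zero_iff_of_nonneg fun i _ => hterm i).1 h0 i hi)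
    rw [hwi.resolve_right (Real.rpow_pos_of_pos (hF i) _).ne', zero_mul]
  have hG : 0 < G / S ^ (1 / p) := div_pos hG0 (Real.rpow_pos_of_pos hS _)
  have hjensen : (1 / p - 1) * h ≤ Real.log (G / S ^ (1 / p)) := by
    have hlog := strictConcaveOn_log_Ioi.concaveOn.le_map_sum (t := Finset.univ)
      (w := fun i => w i * F i / S) (p := fun i => (F i / S) ^ (1 / p - 1))
      (fun i _ => div_nonneg (mul_nonneg (hw i) (hF i).le) hS.le)
      (by rw [← Finset.sum_div, div_self hS.ne'])
      fun i _ => Real.rpow_pos_of_pos (div_pos (hF i) hS) _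
    simp only [smul_eq_mul, Real.log_rpow (div_pos (hF _) hS), hmean] at hlog
    rw [Finset.mul_sum]
    simpa only [mul_left_comm] using hlog
  calc S - (p - 1) * ∑ i, w i * F i * Real.log (F i / S) = S * ((1 / p - 1) * h * p + 1) := by
        rw [hent]; field_simp; ring
    _ ≤ S * Real.exp ((1 / p - 1) * h * p) := by gcongr; exact Real.add_one_le_exp _
    _ ≤ S * Real.exp (Real.log (G / S ^ (1 / p)) * p) := by gcongr
    _ = S * (G / S ^ (1 / p)) ^ p := by rw [Real.rpow_def_of_pos hG]
    _ = G ^ p := by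
        rw [Real.div_rpow hG0.le (by positivity), ← Real.rpow_mul hS.le, one_div_mul_cancel hp.ne',
          Real.rpow_one, mul_div_cancel₀ _ hS.ne']

theorem ent2_eq_traceFun {d : ℕ} {X : Mat d} (hX : X.IsHermitian) :
    ent2 X = 1 / (2 * d) * traceFun (fun x =>
      x ^ 2 * (Real.log ((traceFun (fun y => y ^ 2) X)⁻¹ * x ^ 2) + Real.log d)) X := by
  set s := traceFun (fun y => y ^ 2) X
  have hcont (f : ℝ → ℝ) := continuousOn_spectrum_real X f
  have hsq : X ^ 2 = cfc (fun x : ℝ => x ^ 2) X := (cfc_pow_id X 2 hX.isSelfAdjoint).symm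
  have harg : ((X ^ 2).trace)⁻¹ • X ^ 2 = cfc (fun x : ℝ => s⁻¹ * x ^ 2) X := by
    rw [cfc_const_mul s⁻¹ _ X (hcont _), hsq, trace_cfc, RCLike.real_smul_eq_coe_smul (K := ℂ),
      RCLike.ofReal_inv]
  have hlog : cfc Real.log (cfc (fun x : ℝ => s⁻¹ * x ^ 2) X) + Real.log d • (1 : Mat d) =
      cfc (fun x : ℝ => Real.log (s⁻¹ * x ^ 2) + Real.log d) X := by
    rw [cfc_add X _ _ (hcont _) (hcont _), cfc_const _ X hX.isSelfAdjoint,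
      Algebra.algebraMap_eq_smul_one, cfc_comp' Real.log _ X
        ((X.finite_real_spectrum.image _).continuousOn _) (hcont _) hX.isSelfAdjoint]
  rw [ent2, harg, hlog, hsq, ← cfc_mul _ _ X (hcont _) (hcont _)]
  rfl

theorem ent2_eq_sum_eigenvalues {d : ℕ} [NeZero d] {X : Mat d} (hX : X.PosDef) :
    ent2 X = 1 / 2 * ∑ i, 1 / d * hX.isHermitian.eigenvalues i ^ 2 *
      Real.log (hX.isHermitian.eigenvalues i ^ 2 /
        ∑ j, 1 / d * hX.isHermitian.eigenvalues j ^ 2) := by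
  have hpos (i) : 0 < hX.isHermitian.eigenvalues i ^ 2 := pow_pos (hX.eigenvalues_pos i) 2
  have hs : 0 < ∑ i, hX.isHermitian.eigenvalues i ^ 2 :=
    Finset.sum_pos (fun i _ => hpos i) Finset.univ_nonempty
  have hd : (0 : ℝ) < d := Nat.cast_pos.2 (NeZero.pos d)
  rw [ent2_eq_traceFun hX.isHermitian, traceFun_eq_sum_eigenvalues hX.isHermitian,
    traceFun_eq_sum_eigenvalues hX.isHermitian, Finset.mul_sum, Finset.mul_sum]
  refine Finset.sum_congr rfl fun i _ => ?_
  rw [← Real.log_mul (mul_pos (inv_pos.2 hs) (hpos i)).ne' hd.ne', ← Finset.mul_sum]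
  field_simp

theorem traceFun_sq_sub_ent2_le {d : ℕ} [NeZero d] {X : Mat d} (hX : X.PosDef) {q : ℝ}
    (hq : 0 < q) :
    traceFun (fun x => x ^ 2) X / d - (q - 2) * ent2 X ≤
      (traceFun (fun x => (x ^ 2) ^ (2 / q)) X / d) ^ (q / 2) := by
  have hpos (i) : 0 < hX.isHermitian.eigenvalues i ^ 2 := pow_pos (hX.eigenvalues_pos i) 2
  have hd : (0 : ℝ) < 1 / d := one_div_pos.2 (Nat.cast_pos.2 (NeZero.pos d))
  have h := sum_sub_entropy_le_rpow (fun _ => hd.le) hpos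
    (Finset.sum_pos (fun i _ => mul_pos hd (hpos i)) Finset.univ_nonempty) (half_pos hq)
  rw [traceFun_eq_sum_eigenvalues hX.isHermitian, traceFun_eq_sum_eigenvalues hX.isHermitian,
    ent2_eq_sum_eigenvalues hX]
  simp only [one_div_div, one_div_mul_eq_div, ← Finset.sum_div] at h ⊢
  linear_combination h

end Entropy

section LogSobolev

variable {d : ℕ} {T : Mat d →ₗ[ℂ] Mat d}

theorem dirichlet2_hsAdjoint_comp_sub_id (T : Mat d →ₗ[ℂ] Mat d) {X : Mat d}
    (hX : X.IsHermitian) :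
    dirichlet2 (hsAdjoint T ∘ₗ T - LinearMap.id) X =
      ((X * X).trace.re - ((T X)ᴴ * T X).trace.re) / d := by
  have hadj := trace_hsAdjoint T X (T X)
  rw [hX.eq, trace_mul_comm] at hadj
  rw [dirichlet2, LinearMap.sub_apply, LinearMap.comp_apply, LinearMap.id_apply, Matrix.sub_mul,
    trace_sub, hadj, Complex.sub_re]
  ring

theorem mul_ent2_le_dirichlet2 {L : Mat d →ₗ[ℂ] Mat d} {c : ℝ} (hc : 0 ≤ c)
    (hcL : (c : EReal) ≤ ls2Const L) {X : Mat d} (hX : X.PosDef) (hL : 0 ≤ dirichlet2 L X) :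
    c * ent2 X ≤ dirichlet2 L X := by
  rcases le_or_gt (ent2 X) 0 with hent | hent
  · exact (mul_nonpos_of_nonneg_of_nonpos hc hent).trans hL
  · exact (le_div_iff₀ hent).1 (EReal.coe_le_coe_iff.1 (hcL.trans (iInf₂_le X ⟨hX, hent.ne'⟩)))

theorem sub_two_le_ls2Const {q : ℝ} (hq : (q : EReal) ≤ 2 + 2 * discreteLSConst T) :
    ((q - 2 : ℝ) : EReal) ≤ ls2Const (hsAdjoint T ∘ₗ T - LinearMap.id) := by
  have htwo : (2 : EReal) * ((1 / 2 : ℝ) : EReal) = 1 := by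
    change ((2 : ℝ) : EReal) * _ = 1
    rw [← EReal.coe_mul, mul_one_div_cancel two_ne_zero, EReal.coe_one]
  rw [discreteLSConst, ← mul_assoc, htwo, one_mul] at hq
  exact EReal.sub_le_of_le_add' hq

theorem traceFun_rpow_map_le_of_posDef [NeZero d] (hT : IsKPositive 2 T) (h1 : T 1 = 1)
    (htr : ∀ X, (T X).trace = X.trace) {q : ℝ} (hq : 2 ≤ q)
    (hLS : ((q - 2 : ℝ) : EReal) ≤ ls2Const (hsAdjoint T ∘ₗ T - LinearMap.id))
    {A : Mat d} (hA : A.PosDef) :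
    traceFun (fun x => x ^ q) (T A) / d ≤ (traceFun (fun x => x ^ 2) A / d) ^ (q / 2) := by
  have hspec (x) (hx : x ∈ spectrum ℝ A) : 0 < x :=
    (isStrictlyPositive_iff_posDef.2 hA).spectrum_pos hx
  set X := cfc (fun x : ℝ => x ^ (q / 2)) A
  have hX : X.PosDef := posDef_cfc_rpow hA (q / 2)
  have hTX := (hT.map_posSemidef X hX.posSemidef).isHermitian
  have hdir : dirichlet2 (hsAdjoint T ∘ₗ T - LinearMap.id) X =
      (traceFun (fun x => x ^ 2) X - traceFun (fun x => x ^ 2) (T X)) / d := by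
    rw [dirichlet2_hsAdjoint_comp_sub_id T hX.isHermitian, traceFun_sq hX.isHermitian,
      traceFun_sq hTX, hTX.eq]
    rfl
  have hdir_nonneg : 0 ≤ dirichlet2 (hsAdjoint T ∘ₗ T - LinearMap.id) X := by
    rw [dirichlet2_hsAdjoint_comp_sub_id T hX.isHermitian]
    have h := re_trace_map_mul_le hT h1 htr X
    rw [hX.isHermitian.eq] at h
    exact div_nonneg (sub_nonneg.2 h) (Nat.cast_nonneg d)
  have hLSI := mul_ent2_le_dirichlet2 (sub_nonneg.2 hq) hLS hX hdir_nonneg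
  calc traceFun (fun x => x ^ q) (T A) / d ≤ traceFun (fun x => x ^ 2) (T X) / d := by
        gcongr
        exact traceFun_rpow_map_le hT.map_posSemidef h1 hq hA.posSemidef
    _ ≤ traceFun (fun x => x ^ 2) X / d - (q - 2) * ent2 X := by
        rw [hdir, sub_div] at hLSI
        linarith
    _ ≤ (traceFun (fun x => (x ^ 2) ^ (2 / q)) X / d) ^ (q / 2) :=
        traceFun_sq_sub_ent2_le hX (by linarith)
    _ = (traceFun (fun x => x ^ 2) A / d) ^ (q / 2) := by
        rw [traceFun_cfc hA.isHermitian]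
        congr 2
        refine traceFun_congr fun x hx => ?_
        simp only [rpow_half_sq (hspec x hx).le]
        rw [← Real.rpow_mul (hspec x hx).le, mul_div_cancel₀ _ (by linarith), Real.rpow_two]

theorem traceFun_rpow_map_le_of_posSemidef [NeZero d] (hT : IsKPositive 2 T) (h1 : T 1 = 1)
    (htr : ∀ X, (T X).trace = X.trace) {q : ℝ} (hq : 2 ≤ q)
    (hLS : ((q - 2 : ℝ) : EReal) ≤ ls2Const (hsAdjoint T ∘ₗ T - LinearMap.id))
    {A : Mat d} (hA : A.PosSemidef) :
    traceFun (fun x => x ^ q) (T A) / d ≤ ((A * A).trace.re / d) ^ (q / 2) := by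
  have hbound : ∀ ε > (0 : ℝ), traceFun (fun x => x ^ q) (T A) / d ≤
      (((A + ε • 1) * (A + ε • 1)).trace.re / d) ^ (q / 2) := fun ε hε => by
    have hAε : (A + ε • 1).PosDef := PosDef.posSemidef_add hA (PosDef.one.smul hε)
    have hsub : (T (A + ε • 1) - T A).PosSemidef := by
      rw [map_add, add_sub_cancel_left, LinearMap.map_smul_of_tower, h1]
      exact PosSemidef.one.smul hε.le
    refine le_trans ?_ ((traceFun_rpow_map_le_of_posDef hT h1 htr hq hLS hAε).trans_eq
      (by rw [traceFun_sq hAε.isHermitian]; rfl))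
    gcongr
    exact traceFun_mono (convexOn_rpow (by linarith))
      (Real.monotoneOn_rpow_Ici_of_exponent_nonneg (by linarith)) (hT.map_posSemidef A hA) hsub
  have hcont : Continuous fun ε : ℝ =>
      (((A + ε • 1) * (A + ε • 1)).trace.re / d) ^ (q / 2) :=
    Continuous.rpow_const (by fun_prop) fun _ => Or.inr (by linarith)
  have hlim := (hcont.tendsto 0).mono_left (nhdsWithin_le_nhds (s := Set.Ioi 0))
  simp only [zero_smul, add_zero] at hlim
  exact ge_of_tendsto hlim (eventually_nhdsWithin_of_forall hbound)

end LogSobolev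

section WeightedNorm

variable {d : ℕ}

theorem wnorm_eq_traceFun (p : ℝ) (Y : Mat d) :
    wnorm p Y = (traceFun (fun s => √s ^ p) (Yᴴ * Y) / d) ^ (1 / p) := by
  have hcfc : (cfc (fun s : ℝ => s ^ p) (matAbs Y)).trace.re =
      traceFun (fun s => √s ^ p) (Yᴴ * Y) :=
    traceFun_cfc (isHermitian_conjTranspose_mul_self Y) _ _
  rw [wnorm, hcfc, Real.div_rpow (traceFun_nonneg fun s _ => by positivity) (Nat.cast_nonneg d)]
  ring

theorem wnorm_nonneg (p : ℝ) (Y : Mat d) : 0 ≤ wnorm p Y := by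
  rw [wnorm_eq_traceFun]
  exact Real.rpow_nonneg
    (div_nonneg (traceFun_nonneg fun s _ => by positivity) (Nat.cast_nonneg d)) _

theorem wnorm_two (Y : Mat d) : wnorm 2 Y = ((Yᴴ * Y).trace.re / d) ^ (1 / 2 : ℝ) := by
  have hY := posSemidef_conjTranspose_mul_self Y
  have hid : traceFun (fun s => √s ^ (2 : ℝ)) (Yᴴ * Y) = traceFun id (Yᴴ * Y) :=
    traceFun_congr fun s hs => by
      rw [Real.rpow_two, Real.sq_sqrt (spectrum_nonneg_of_nonneg hY.nonneg hs), id]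
  rw [wnorm_eq_traceFun, hid, traceFun, cfc_id ℝ (Yᴴ * Y) hY.isHermitian.isSelfAdjoint]
  rfl

theorem wnorm_mono [NeZero d] {p q : ℝ} (hp : 0 < p) (hpq : p ≤ q) (Y : Mat d) :
    wnorm p Y ≤ wnorm q Y := by
  have hH := isHermitian_conjTranspose_mul_self Y
  have hd : (d : ℝ) ≠ 0 := NeZero.ne _
  have hq := hp.trans_le hpq
  have power_mean := Real.rpow_arith_mean_le_arith_mean_rpow Finset.univ (fun _ => 1 / (d : ℝ))
    (fun i => √(hH.eigenvalues i) ^ p) (fun _ _ => by positivity) (by simp [hd])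
    (fun _ _ => by positivity) ((one_le_div hp).2 hpq)
  simp only [← Real.rpow_mul (Real.sqrt_nonneg _), mul_div_cancel₀ _ hp.ne',
    one_div_mul_eq_div, ← Finset.sum_div] at power_mean
  rw [wnorm_eq_traceFun, wnorm_eq_traceFun, traceFun_eq_sum_eigenvalues hH,
    traceFun_eq_sum_eigenvalues hH]
  refine le_of_eq_of_le ?_ (Real.rpow_le_rpow (by positivity) power_mean (one_div_pos.2 hq).le)
  rw [← Real.rpow_mul (by positivity)]
  congr 1
  field_simp

theorem opNorm_le_one {p q : ℝ} {T : Mat d →ₗ[ℂ] Mat d} (h : ∀ Y, wnorm q (T Y) ≤ wnorm p Y) :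
    opNorm p q T ≤ 1 :=
  iSup₂_le fun Y _ => ENNReal.ofReal_le_one.2 (div_le_one_of_le₀ (h Y) (wnorm_nonneg p Y))

theorem wnorm_two_map_le {T : Mat d →ₗ[ℂ] Mat d} (hT : IsKPositive 2 T) (h1 : T 1 = 1)
    (htr : ∀ X, (T X).trace = X.trace) (Y : Mat d) : wnorm 2 (T Y) ≤ wnorm 2 Y := by
  have hpos := (Complex.nonneg_iff.1 (posSemidef_conjTranspose_mul_self (T Y)).trace_nonneg).1
  rw [wnorm_two, wnorm_two]
  refine Real.rpow_le_rpow (by positivity) ?_ one_half_pos.le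
  gcongr ?_ / _
  exact re_trace_map_mul_le hT h1 htr Y

theorem wnorm_map_le_wnorm_two [NeZero d] {T : Mat d →ₗ[ℂ] Mat d} (hT : IsKPositive 2 T)
    (h1 : T 1 = 1) (htr : ∀ X, (T X).trace = X.trace) {q : ℝ} (hq : 2 ≤ q)
    (hLS : ((q - 2 : ℝ) : EReal) ≤ ls2Const (hsAdjoint T ∘ₗ T - LinearMap.id)) (Y : Mat d) :
    wnorm q (T Y) ≤ wnorm 2 Y := by
  have hblock := hT.map_fromBlocks (posSemidef_fromBlocks_abs Y)
  rw [← (isHermitian_fromBlocks_iff.1 hblock.isHermitian).2.1] at hblock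
  have hsplit := traceFun_le_of_posSemidef_fromBlocks (convexOn_rpow (by linarith : 1 ≤ q))
    (Real.monotoneOn_rpow_Ici_of_exponent_nonneg (by linarith)) hblock
  have habs (Z : Mat d) : traceFun (fun x => x ^ q) (T (CFC.abs Z)) / d ≤
      ((Zᴴ * Z).trace.re / d) ^ (q / 2) := by
    rw [← star_eq_conjTranspose, ← CFC.abs_mul_abs]
    exact traceFun_rpow_map_le_of_posSemidef hT h1 htr hq hLS (CFC.abs_nonneg Z).posSemidef
  have hstar := habs Yᴴ
  rw [conjTranspose_conjTranspose, trace_mul_comm] at hstar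
  have hbound : traceFun (fun s => √s ^ q) ((T Y)ᴴ * T Y) / d ≤
      ((Yᴴ * Y).trace.re / d) ^ (q / 2) := by
    have := div_le_div_of_nonneg_right hsplit (Nat.cast_nonneg (α := ℝ) d)
    rw [add_div, mul_div_assoc] at this
    linarith [habs Y]
  have hY := (Complex.nonneg_iff.1 (posSemidef_conjTranspose_mul_self Y).trace_nonneg).1
  calc wnorm q (T Y) ≤ (((Yᴴ * Y).trace.re / d) ^ (q / 2)) ^ (1 / q) := by
        rw [wnorm_eq_traceFun]
        have := traceFun_nonneg (A := (T Y)ᴴ * T Y) (f := fun s => √s ^ q)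
          fun s _ => by positivity
        gcongr
    _ = wnorm 2 Y := by
        rw [wnorm_two, ← Real.rpow_mul (by positivity)]
        congr 1
        field_simp

end WeightedNorm

end QHyper

theorem theorem4p6_general {d : ℕ} [NeZero d] {T : QHyper.Mat d →ₗ[ℂ] QHyper.Mat d}
    (hT : QHyper.IsKPositive 2 T) (h1 : T 1 = 1) (htr : ∀ X, (T X).trace = X.trace)
    {q : ℝ} (hq0 : 0 < q) (hq : (q : EReal) ≤ 2 + 2 * QHyper.discreteLSConst T) :
    QHyper.opNorm 2 q T ≤ 1 := by
  refine QHyper.opNorm_le_one fun Y => ?_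
  rcases le_total q 2 with hq2 | hq2
  · exact (QHyper.wnorm_mono hq0 hq2 (T Y)).trans (QHyper.wnorm_two_map_le hT h1 htr Y)
  · exact QHyper.wnorm_map_le_wnorm_two hT h1 htr hq2 (QHyper.sub_two_le_ls2Const hq) Y

theorem theorem4p6 (d : ℕ) (hd : 1 ≤ d) (T : QHyper.Mat d →ₗ[ℂ] QHyper.Mat d)
    (hT : QHyper.IsDoublyStochasticChannel T)
    (hprim : QHyper.IsPrimitive (QHyper.hsAdjoint T ∘ₗ T))
    (q : ℝ) (hq1 : 1 ≤ q)
    (hq : (q : EReal) ≤ 2 + 2 * QHyper.discreteLSConst T) :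
    QHyper.opNorm 2 q T ≤ 1 := by
  have : NeZero d := ⟨by omega⟩
  exact theorem4p6_general (hT.channel.completelyPositive 2) hT.map_one
    hT.channel.trace_preserving (by linarith) hq
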